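/- Let $k,\alpha,\beta,\gamma>0$ and $\mu\in\mathbb{R}$. Consider the Int-GARCH(1,1,1) model, indexed by $t\in\mathbb{Z}$, on a probability space: $\{\epsilon_t\}$ are i.i.d. $N(0,1)$, $\{\eta_t\}$ are i.i.d. $\Gamma(k,1)$ (shape $k$, scale $1$), the two sequences are independent of each other, the interval-valued returns are $$r_t=h_t\cdot[\epsilon_t-\eta_t,\ \epsilon_t+\eta_t]=[\lambda_t-\delta_t,\ \lambda_t+\delta_t]$$ with center $\lambda_t$ and radius $\delta_t$, and the scale process $h_t\ge 0$ is a real-valued process satisfying, almost surely for every $t\in\mathbb{Z}$, $$h_t=\mu+\alpha|\lambda_{t-1}|+\beta\,\delta_{t-1}+\gamma h_{t-1}.$$ Put $x_t=\alpha|\epsilon_{t-1}|+\beta\eta_{t-1}+\gamma$, so that $h_t=\mu+x_th_{t-1}$ almost surely. Assume that $\{r_t\}$ starts from its infinite past with a finite mean, in the sense that $$\liminf_{t\to-\infty}E\big(|\lambda_t|+\delta_t\big)<\infty,$$ and that the mean-stationarity condition $E(x_t)<1$ holds. Then the process $\{h_t\}_{t\in\mathbb{Z}}$ is strictly stationary (its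 finite-dimensional distributions are invariant under time shifts) and ergodic (the shift on $\mathbb{R}^{\mathbb{Z}}$ is ergodic for the law of $\{h_t\}$). If in addition $E(x_t^p)<1$ for some real $p>0$, then $E(h_t^p)<\infty$ for every $t$ (for that $p$). -/

import Mathlib

open MeasureTheory ProbabilityTheory Filter
open scoped ENNReal Pointwise

namespace IntGARCH

/-- The center of a compact interval, `(a + b) / 2` for `[a, b]`. -/
noncomputable def center (A : Set ℝ) : ℝ := (sInf A + sSup A) / 2

/-- The radius of a compact interval, `(b - a) / 2` for `[a, b]`. -/
noncomputable def radius (A : Set ℝ) : ℝ := (sSup A - sInf A) / 2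

/-- The interval-valued innovation `v_t = [ε_t - η_t, ε_t + η_t]`. -/
def innovation {Ω : Type*} (ε η : ℤ → Ω → ℝ) (t : ℤ) (ω : Ω) : Set ℝ :=
  Set.Icc (ε t ω - η t ω) (ε t ω + η t ω)

/-- The Int-GARCH(1,1,1) model on the time set `ℤ` (so that it runs from its infinite past), with
interval-valued returns `r`, scale process `h` and errors `ε`, `η`. The product `h_t • v_t` is
the scalar multiple of a set. The law `Γ(k, 1)` of `η_t` has shape `k` and scale `1`. -/
structure Model {Ω : Type*} [MeasurableSpace Ω] (P : Measure Ω) (k μ α β γ : ℝ)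
    (ε η h : ℤ → Ω → ℝ) (r : ℤ → Ω → Set ℝ) : Prop where
  k_pos : 0 < k
  alpha_pos : 0 < α
  beta_pos : 0 < β
  gamma_pos : 0 < γ
  measurable_eps : ∀ t, Measurable (ε t)
  measurable_eta : ∀ t, Measurable (η t)
  measurable_h : ∀ t, Measurable (h t)
  law_eps : ∀ t, HasLaw (ε t) (gaussianReal 0 1) P
  law_eta : ∀ t, HasLaw (η t) (gammaMeasure k 1) P
  indep_eps : iIndepFun ε P
  indep_eta : iIndepFun η P
  indep_eps_eta : IndepFun (fun ω t => ε t ω) (fun ω t => η t ω) P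
  h_nonneg : ∀ t, ∀ᵐ ω ∂P, 0 ≤ h t ω
  return_eq : ∀ t, ∀ᵐ ω ∂P, r t ω = h t ω • innovation ε η t ω
  scale_eq : ∀ t, ∀ᵐ ω ∂P,
    h t ω = μ + α * |center (r (t - 1) ω)| + β * radius (r (t - 1) ω) + γ * h (t - 1) ω

/-- The returns start from the infinite past with a finite mean: `E ‖r_t‖` does not tend to
infinity as `t → -∞`. Here `‖[c - ρ, c + ρ]‖ = |c| + ρ` is the largest absolute value of a point
of the interval. -/
def FiniteMeanPast {Ω : Type*} [MeasurableSpace Ω] (P : Measure Ω) (r : ℤ → Ω → Set ℝ) : Prop :=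
  liminf (fun t : ℤ => ∫⁻ ω, ENNReal.ofReal (|center (r t ω)| + radius (r t ω)) ∂P) atBot < ∞

/-- The random coefficient `x_t = α |ε_{t-1}| + β η_{t-1} + γ`. -/
def coeff {Ω : Type*} (α β γ : ℝ) (ε η : ℤ → Ω → ℝ) (t : ℤ) (ω : Ω) : ℝ :=
  α * |ε (t - 1) ω| + β * η (t - 1) ω + γ

/-- Strict stationarity: the finite-dimensional distributions are invariant under time shifts. -/
def StrictlyStationary {Ω : Type*} [MeasurableSpace Ω] (P : Measure Ω) (X : ℤ → Ω → ℝ) : Prop :=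
  ∀ (n : ℕ) (t : Fin n → ℤ) (s : ℤ),
    P.map (fun ω i => X (t i + s) ω) = P.map (fun ω i => X (t i) ω)

/-- The shift on the space of two-sided real sequences. -/
def shift (y : ℤ → ℝ) : ℤ → ℝ := fun t => y (t + 1)

/-- Ergodicity of a process: the shift is ergodic for the law of the process on path space. -/
def ErgodicProcess {Ω : Type*} [MeasurableSpace Ω] (P : Measure Ω) (X : ℤ → Ω → ℝ) : Prop :=
  Ergodic shift (P.map (fun ω t => X t ω))

end IntGARCH

namespace IntGARCH

/-! Write `x_t` for the coefficients. Iterating `h_t = μ + x_t h_{t-1}` backwards gives `μ` times a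
partial sum of the perpetuity `1 + x_t + x_t x_{t-1} + ⋯`, plus the remainder `x_t ⋯ x_{t-n+1}
h_{t-n}`. The `x_t` are i.i.d., almost surely nonnegative and of mean below 1, so the perpetuity has
finite mean; it is thus almost surely finite and its terms tend to 0. The finite-mean past makes `h`
tight along some times tending to `-∞`, so almost surely `h_{t-n}` stays bounded for infinitely many
`n`, and the remainder must vanish (`eq_perpetuity_of_recursion`, `Model.ae_eq_perpetuity`).

Thus `h` is a measurable, shift-equivariant function of an i.i.d. sequence: it inherits
stationarity, and ergodicity from `ergodic_shift_infinitePi`. For moments, the `n`-th product has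
`p`-th moment `E(x^p)^n`, and the series is summed in `L^p` (`lintegral_tsum_rpow_lt_top`). -/

/-! ### Ergodicity of the Bernoulli shift -/

open Measure in
lemma measurePreserving_shift_infinitePi (ρ : Measure ℝ) [IsProbabilityMeasure ρ] (n : ℤ) :
    MeasurePreserving (fun (y : ℤ → ℝ) t => y (t + n)) (infinitePi fun _ : ℤ => ρ)
      (infinitePi fun _ : ℤ => ρ) :=
  ⟨by fun_prop, map_infinitePi_infinitePi_of_inj (P := fun _ : ℤ => ρ) (add_left_injective n)⟩

lemma iterate_shift (n : ℕ) (y : ℤ → ℝ) : shift^[n] y = fun t => y (t + n) := by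
  induction n with
  | zero => simp
  | succ n ih =>
    rw [Function.iterate_succ_apply', ih]
    funext t
    simp only [shift]
    congr 1
    push_cast
    ring

lemma exists_disjoint_translate (s : Finset ℤ) :
    ∃ n : ℕ, Disjoint s (s.image fun t => t + (n : ℤ)) := by
  obtain ⟨b, hb⟩ := s.bddAbove
  obtain ⟨a, ha⟩ := s.bddBelow
  refine ⟨(b - a + 1).toNat, Finset.disjoint_left.2 fun x hx hx' => ?_⟩
  obtain ⟨y, hy, rfl⟩ := Finset.mem_image.1 hx'
  have h1 := hb hx
  have h2 := ha hy
  have h3 := Int.self_le_toNat (b - a + 1)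
  lia

/-- A cylinder is independent of all its far enough translates under a Bernoulli shift. -/
lemma exists_measure_inter_preimage_iterate_shift (ρ : Measure ℝ) [IsProbabilityMeasure ρ]
    {B : Set (ℤ → ℝ)} (hB : B ∈ measurableCylinders fun _ : ℤ => ℝ) :
    ∃ n : ℕ, (Measure.infinitePi fun _ : ℤ => ρ) (B ∩ shift^[n] ⁻¹' B) =
      (Measure.infinitePi fun _ : ℤ => ρ) B * (Measure.infinitePi fun _ : ℤ => ρ) B := by
  set ν := Measure.infinitePi fun _ : ℤ => ρ
  have hBm := MeasurableSet.of_mem_measurableCylinders hB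
  obtain ⟨s, S, hS, rfl⟩ := (mem_measurableCylinders _).1 hB
  obtain ⟨n, hn⟩ := exists_disjoint_translate s
  refine ⟨n, ?_⟩
  have hind : iIndepFun (fun (t : ℤ) (y : ℤ → ℝ) => y t) ν :=
    iIndepFun_infinitePi (X := fun _ x => x) (by fun_prop)
  have h2 := hind.indepFun_finset s _ hn (by fun_prop)
  let φ : ((s.image fun t => t + (n : ℤ)) → ℝ) → (s → ℝ) :=
    fun z t => z ⟨t + n, Finset.mem_image_of_mem _ t.2⟩
  have h3 := h2.measure_inter_preimage_eq_mul S (φ ⁻¹' S) hS (by measurability)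
  have hfun : shift^[n] = fun (y : ℤ → ℝ) t => y (t + n) := funext (iterate_shift n)
  have h4 : ν (shift^[n] ⁻¹' cylinder s S) = ν (cylinder s S) := by
    rw [hfun]
    exact (measurePreserving_shift_infinitePi ρ n).measure_preimage hBm.nullMeasurableSet
  have h5 : (fun (a : ℤ → ℝ) (i : (s.image fun t => t + (n : ℤ))) => a i) ⁻¹' (φ ⁻¹' S) =
      shift^[n] ⁻¹' cylinder s S := by
    rw [hfun]
    rfl
  have h6 : (fun (a : ℤ → ℝ) (i : s) => a i) ⁻¹' S = cylinder s S := rfl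
  rw [h5, h6, h4] at h3
  exact h3

/-- The two-sided Bernoulli shift is ergodic. -/
theorem ergodic_shift_infinitePi (ρ : Measure ℝ) [IsProbabilityMeasure ρ] :
    Ergodic shift (Measure.infinitePi fun _ : ℤ => ρ) := by
  set ν := Measure.infinitePi fun _ : ℤ => ρ with hν
  have hmp : MeasurePreserving shift ν ν := measurePreserving_shift_infinitePi ρ 1
  refine ⟨hmp, ⟨fun s hs hinv => ?_⟩⟩
  have hdense : ν.MeasureDense (measurableCylinders fun _ : ℤ => ℝ) :=
    Measure.MeasureDense.of_generateFrom_isSetAlgebra_finite ν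
      isSetAlgebra_measurableCylinders generateFrom_measurableCylinders.symm
  -- Approximate `s` by a cylinder `B`. By invariance `s` is also close to `B ∩ T⁻ⁿB`, of measure
  -- `ν(B)²` for suitable `n`. This costs `2δ`, and replacing `ν(B)²` by `ν(s)²` costs another `2δ`.
  have key : ∀ δ : ℝ, 0 < δ → |ν.real s - ν.real s * ν.real s| ≤ 4 * δ := by
    intro δ hδ
    obtain ⟨B, hB, hsB⟩ := hdense.approx s hs (measure_ne_top _ _) δ hδ
    have hBm := MeasurableSet.of_mem_measurableCylinders hB
    obtain ⟨n, hn⟩ := exists_measure_inter_preimage_iterate_shift ρ hB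
    have hsn : shift^[n] ⁻¹' s = s := by
      rw [Set.preimage_iterate_eq]
      exact Function.iterate_fixed hinv n
    have hsB' : ν.real (symmDiff s B) ≤ δ := ENNReal.toReal_le_of_le_ofReal hδ.le hsB.le
    have hmpn := hmp.iterate n
    have hpre : ν.real (symmDiff (shift^[n] ⁻¹' s) (shift^[n] ⁻¹' B)) ≤ δ := by
      rw [← Set.preimage_symmDiff, measureReal_def, hmpn.measure_preimage
        (hs.symmDiff hBm).nullMeasurableSet]
      exact hsB'
    have h1 : |ν.real s - ν.real B| ≤ δ :=
      (abs_measureReal_sub_le_measureReal_symmDiff hs.nullMeasurableSet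
        hBm.nullMeasurableSet).trans hsB'
    have hBn : MeasurableSet (shift^[n] ⁻¹' B) := hmpn.measurable hBm
    have h2 : |ν.real s - ν.real (B ∩ shift^[n] ⁻¹' B)| ≤ δ + δ := by
      refine (abs_measureReal_sub_le_measureReal_symmDiff hs.nullMeasurableSet
        (hBm.inter hBn).nullMeasurableSet).trans ?_
      have : symmDiff s (B ∩ shift^[n] ⁻¹' B) ⊆
          symmDiff s B ∪ symmDiff (shift^[n] ⁻¹' s) (shift^[n] ⁻¹' B) := by
        rw [hsn]
        intro x hx
        simp only [Set.mem_symmDiff, Set.mem_inter_iff, Set.mem_union] at hx ⊢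
        tauto
      exact (measureReal_mono this).trans ((measureReal_union_le _ _).trans
        (add_le_add hsB' hpre))
    have h3 : ν.real (B ∩ shift^[n] ⁻¹' B) = ν.real B * ν.real B := by
      rw [measureReal_def, hn, ENNReal.toReal_mul]
      rfl
    rw [h3] at h2
    have hs0 : 0 ≤ ν.real s := measureReal_nonneg
    have hs1 : ν.real s ≤ 1 := measureReal_le_one
    have hB0 : 0 ≤ ν.real B := measureReal_nonneg
    have hB1 : ν.real B ≤ 1 := measureReal_le_one
    have h4 : |ν.real B * ν.real B - ν.real s * ν.real s| ≤ 2 * δ := by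
      have : ν.real B * ν.real B - ν.real s * ν.real s =
        -((ν.real B + ν.real s) * (ν.real s - ν.real B)) := by ring
      rw [this, abs_neg, abs_mul, abs_of_nonneg (add_nonneg hB0 hs0)]
      exact mul_le_mul (by linarith) h1 (abs_nonneg _) (by norm_num)
    have := abs_sub_le (ν.real s) (ν.real B * ν.real B) (ν.real s * ν.real s)
    linarith
  have hzero : ν.real s - ν.real s * ν.real s = 0 := by
    by_contra hne
    have hpos := abs_pos.2 hne
    have := key (|ν.real s - ν.real s * ν.real s| / 8) (by positivity)
    linarith
  have hcases : ν.real s = 0 ∨ ν.real s = 1 := by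
    have : ν.real s * (1 - ν.real s) = 0 := by linarith
    rcases mul_eq_zero.1 this with h | h
    · exact .inl h
    · exact .inr (by linarith)
  rw [eventuallyConst_set']
  rcases hcases with h | h
  · left
    rw [measureReal_eq_zero_iff] at h
    exact ae_eq_empty.2 h
  · right
    rw [ae_eq_univ, prob_compl_eq_zero_iff hs]
    rwa [measureReal_def, ENNReal.toReal_eq_one_iff] at h

/-! ### Perpetuities along a fixed path -/

/-- The product `y_t y_{t-1} ⋯ y_{t-n+1}` of the nonnegative parts of a sequence. -/
noncomputable def backwardProd (y : ℤ → ℝ) (t : ℤ) (n : ℕ) : ℝ≥0∞ :=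
  ∏ j ∈ Finset.range n, ENNReal.ofReal (y (t - j))

/-- The perpetuity `1 + y_t + y_t y_{t-1} + ⋯`. -/
noncomputable def perpetuity (y : ℤ → ℝ) (t : ℤ) : ℝ≥0∞ := ∑' n, backwardProd y t n

@[fun_prop]
lemma measurable_backwardProd (t : ℤ) (n : ℕ) :
    Measurable fun y : ℤ → ℝ => backwardProd y t n := by
  unfold backwardProd
  fun_prop

@[fun_prop]
lemma measurable_perpetuity (t : ℤ) : Measurable fun y : ℤ → ℝ => perpetuity y t := by
  unfold perpetuity
  fun_prop

lemma perpetuity_translate (y : ℤ → ℝ) (s t : ℤ) :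
    perpetuity (fun u => y (u + s)) t = perpetuity y (t + s) := by
  unfold perpetuity backwardProd
  simp only [sub_add_eq_add_sub]

lemma eq_partial_sum_of_recursion {y h : ℤ → ℝ} {μ : ℝ} (hrec : ∀ t, h t = μ + y t * h (t - 1))
    (t : ℤ) (n : ℕ) :
    h t = μ * ∑ i ∈ Finset.range n, ∏ j ∈ Finset.range i, y (t - j) +
      (∏ j ∈ Finset.range n, y (t - j)) * h (t - n) := by
  induction n with
  | zero => simp
  | succ n ih =>
    rw [ih, hrec (t - n), Finset.sum_range_succ, Finset.prod_range_succ]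
    push_cast
    rw [sub_sub]
    ring

/-- A solution of the recursion `h_t = μ + y_t h_{t-1}` that does not blow up in the infinite past
is given by the perpetuity. -/
lemma eq_perpetuity_of_recursion {y h : ℤ → ℝ} {μ : ℝ} (hy : ∀ t, 0 ≤ y t)
    (hrec : ∀ t, h t = μ + y t * h (t - 1)) {t : ℤ} (hfin : perpetuity y t ≠ ∞) {M : ℝ}
    (hM : ∃ᶠ n : ℕ in atTop, |h (t - n)| ≤ M) :
    h t = μ * (perpetuity y t).toReal := by
  have ha : ∀ n, (backwardProd y t n).toReal = ∏ j ∈ Finset.range n, y (t - j) := fun n => by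
    simp [backwardProd, ENNReal.toReal_prod, ENNReal.toReal_ofReal (hy _)]
  have hsum : HasSum (fun n => (backwardProd y t n).toReal) (perpetuity y t).toReal := by
    rw [perpetuity, ENNReal.tsum_toReal_eq (ENNReal.ne_top_of_tsum_ne_top hfin)]
    exact (ENNReal.summable_toReal hfin).hasSum
  have hzero := hsum.summable.tendsto_atTop_zero
  simp only [ha] at hsum hzero
  have hlim : Tendsto (fun n : ℕ => (∏ j ∈ Finset.range n, y (t - j)) * h (t - n)) atTop
      (nhds (h t - μ * (perpetuity y t).toReal)) := by
    refine ((hsum.tendsto_sum_nat.const_mul μ).const_sub (h t)).congr fun n => ?_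
    linarith [eq_partial_sum_of_recursion hrec t n]
  -- The remainder converges. At the infinitely many `n` with `|h (t - n)| ≤ M` it is at most the
  -- product times `M`, which tends to 0, so its limit cannot be nonzero.
  by_contra hne
  have hL : 0 < |h t - μ * (perpetuity y t).toReal| := abs_pos.2 (sub_ne_zero.2 hne)
  have h1 := hlim.abs.eventually_const_lt (half_lt_self hL)
  have h2 : ∀ᶠ n : ℕ in atTop, (∏ j ∈ Finset.range n, y (t - j)) * M <
      |h t - μ * (perpetuity y t).toReal| / 2 := by
    have := hzero.mul_const M
    rw [zero_mul] at this
    exact this.eventually_lt_const (half_pos hL)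
  obtain ⟨n, hn, h1, h2⟩ := (hM.and_eventually (h1.and h2)).exists
  have hp : 0 ≤ ∏ j ∈ Finset.range n, y (t - j) := Finset.prod_nonneg fun j _ => hy _
  rw [abs_mul, abs_of_nonneg hp] at h1
  have := mul_le_mul_of_nonneg_left hn hp
  linarith

/-! ### Tightness and moments of random perpetuities -/

variable {Ω : Type*} [MeasurableSpace Ω] {P : Measure Ω}

/-- If a sequence of random variables is tight along a subsequence, then almost surely it does not
diverge to infinity. -/
lemma ae_frequently_abs_le_of_tight {Z : ℕ → Ω → ℝ}
    (htight : ∀ δ : ℝ≥0∞, 0 < δ → ∃ M : ℕ, ∃ᶠ n in atTop, P {ω | (M : ℝ) < |Z n ω|} ≤ δ) :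
    ∀ᵐ ω ∂P, ∃ M : ℝ, ∃ᶠ n in atTop, |Z n ω| ≤ M := by
  rw [ae_iff]
  refine le_antisymm (le_of_forall_pos_le_add fun δ hδ => ?_) zero_le
  obtain ⟨M, hM⟩ := htight δ hδ
  rw [zero_add]
  -- Divergence forces `|Z n| > M` from some `N` on. Each `A N` lies inside a single event of
  -- probability at most `δ`, and continuity from below passes this bound to the union.
  let A : ℕ → Set Ω := fun N => ⋂ n ≥ N, {ω | (M : ℝ) < |Z n ω|}
  have hA : Monotone A := fun N N' hN ω hω => by
    simp only [A, Set.mem_iInter] at hω ⊢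
    exact fun n hn => hω n (hN.trans hn)
  calc P {ω | ¬ ∃ M : ℝ, ∃ᶠ n in atTop, |Z n ω| ≤ M} ≤ P (⋃ N, A N) := by
        refine measure_mono fun ω hω => ?_
        simp only [Set.mem_ofPred_eq, not_exists, not_frequently, not_le] at hω
        obtain ⟨N, hN⟩ := eventually_atTop.1 (hω M)
        exact Set.mem_iUnion.2 ⟨N, Set.mem_iInter₂.2 hN⟩
    _ = ⨆ N, P (A N) := hA.measure_iUnion
    _ ≤ δ := iSup_le fun N => by
        obtain ⟨n, hn, hle⟩ := (frequently_atTop.1 hM) N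
        exact (measure_mono (Set.iInter₂_subset n hn)).trans hle

lemma lintegral_backwardProd_rpow {X : ℤ → Ω → ℝ} (hX : ∀ t, Measurable (X t))
    (hind : iIndepFun X P) {p : ℝ} (hp : 0 ≤ p) {q : ℝ≥0∞}
    (hq : ∀ t, ∫⁻ ω, ENNReal.ofReal (X t ω) ^ p ∂P = q) (t : ℤ) (n : ℕ) :
    ∫⁻ ω, backwardProd (fun s => X s ω) t n ^ p ∂P = q ^ n := by
  have hinj : Function.Injective fun j : ℕ => t - (j : ℤ) := fun a b hab => by
    simpa using hab
  have h1 : iIndepFun (fun (j : ℕ) ω => ENNReal.ofReal (X (t - j) ω) ^ p) P :=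
    (hind.precomp hinj).comp (fun _ x => ENNReal.ofReal x ^ p) fun _ => by fun_prop
  simp only [backwardProd, ← ENNReal.prod_rpow_of_nonneg hp]
  rw [lintegral_prod_eq_prod_lintegral_of_indepFun _ _ h1 fun j => by fun_prop]
  simp [hq]

lemma ae_perpetuity_ne_top {X : ℤ → Ω → ℝ} (hX : ∀ t, Measurable (X t))
    (hind : iIndepFun X P) {m : ℝ≥0∞} (hm : m < 1)
    (hmean : ∀ t, ∫⁻ ω, ENNReal.ofReal (X t ω) ∂P = m) (t : ℤ) :
    ∀ᵐ ω ∂P, perpetuity (fun s => X s ω) t ≠ ∞ := by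
  have hXm : Measurable fun ω s => X s ω := measurable_pi_iff.2 hX
  have h1 : ∫⁻ ω, perpetuity (fun s => X s ω) t ∂P ≠ ∞ := by
    unfold perpetuity
    have hmeas (n : ℕ) : AEMeasurable (fun ω => backwardProd (fun s => X s ω) t n) P :=
      ((measurable_backwardProd t n).comp hXm).aemeasurable
    rw [lintegral_tsum hmeas]
    have h2 := lintegral_backwardProd_rpow hX hind zero_le_one (q := m)
      (by simpa using hmean) t
    simp only [ENNReal.rpow_one] at h2
    simp only [h2, ENNReal.tsum_geometric]
    simpa [tsub_eq_zero_iff_le] using hm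
  filter_upwards [ae_lt_top ((measurable_perpetuity t).comp hXm) h1] with ω hω
  exact hω.ne

lemma sum_rpow_le_sum_rpow_of_le_one {ι : Type*} (s : Finset ι) (f : ι → ℝ≥0∞) {p : ℝ}
    (hp : 0 < p) (hp1 : p ≤ 1) : (∑ i ∈ s, f i) ^ p ≤ ∑ i ∈ s, f i ^ p := by
  classical
  induction s using Finset.induction_on with
  | empty => simp [hp]
  | insert a s ha ih =>
    rw [Finset.sum_insert ha, Finset.sum_insert ha]
    exact (ENNReal.rpow_add_le_add_rpow _ _ hp.le hp1).trans (by gcongr)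

lemma lintegral_Lp_sum_le {ι : Type*} (s : Finset ι) {f : ι → Ω → ℝ≥0∞}
    (hf : ∀ i, Measurable (f i)) {p : ℝ} (hp1 : 1 ≤ p) :
    (∫⁻ ω, (∑ i ∈ s, f i ω) ^ p ∂P) ^ (1 / p) ≤ ∑ i ∈ s, (∫⁻ ω, f i ω ^ p ∂P) ^ (1 / p) := by
  classical
  have hp : 0 < p := by linarith
  induction s using Finset.induction_on with
  | empty => simp [hp]
  | insert a s ha ih =>
    simp only [Finset.sum_insert ha]
    have := ENNReal.lintegral_Lp_add_le (μ := P) (hf a).aemeasurable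
      (Finset.measurable_sum s fun i _ => hf i).aemeasurable hp1
    simp only [Pi.add_apply] at this
    exact this.trans (by gcongr)

/-- If the `L^p` norms of the terms decay geometrically then the series has a finite `p`-th
moment. -/
lemma lintegral_tsum_rpow_lt_top {f : ℕ → Ω → ℝ≥0∞} (hf : ∀ n, Measurable (f n)) {p : ℝ}
    (hp : 0 < p) {q : ℝ≥0∞} (hq : q < 1) (hfq : ∀ n, ∫⁻ ω, f n ω ^ p ∂P = q ^ n) :
    ∫⁻ ω, (∑' n, f n ω) ^ p ∂P < ∞ := by
  have hgeom : ∀ a : ℝ≥0∞, a < 1 → ∑' n : ℕ, a ^ n < ∞ := fun a ha => by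
    rw [ENNReal.tsum_geometric]
    simpa [tsub_eq_zero_iff_le, lt_top_iff_ne_top] using ha
  have hbound : ∃ C < ∞, ∀ n, ∫⁻ ω, (∑ i ∈ Finset.range n, f i ω) ^ p ∂P ≤ C := by
    -- The partial sums are bounded uniformly by subadditivity of `x ↦ x ^ p` when `p ≤ 1`, and by
    -- Minkowski with ratio `q ^ (1 / p)` when `p ≥ 1`.
    rcases le_total p 1 with hp1 | hp1
    · refine ⟨∑' n : ℕ, q ^ n, hgeom q hq, fun n => ?_⟩
      calc ∫⁻ ω, (∑ i ∈ Finset.range n, f i ω) ^ p ∂P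
          ≤ ∫⁻ ω, ∑ i ∈ Finset.range n, f i ω ^ p ∂P :=
            lintegral_mono fun ω => sum_rpow_le_sum_rpow_of_le_one _ _ hp hp1
        _ = ∑ i ∈ Finset.range n, q ^ i := by
            rw [lintegral_finsetSum _ fun i _ => by fun_prop]
            simp [hfq]
        _ ≤ _ := ENNReal.sum_le_tsum _
    · have hr : q ^ (1 / p) < 1 := ENNReal.rpow_lt_one hq (by positivity)
      refine ⟨(∑' n : ℕ, (q ^ (1 / p)) ^ n) ^ p,
        ENNReal.rpow_lt_top_of_nonneg hp.le (hgeom _ hr).ne, fun n => ?_⟩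
      rw [← ENNReal.rpow_inv_le_iff hp, ← one_div]
      refine (lintegral_Lp_sum_le _ hf hp1).trans (le_trans (le_of_eq ?_)
        (ENNReal.sum_le_tsum (Finset.range n)))
      refine Finset.sum_congr rfl fun i _ => ?_
      rw [hfq, ← ENNReal.rpow_natCast, ← ENNReal.rpow_natCast, ← ENNReal.rpow_mul,
        ← ENNReal.rpow_mul, mul_comm]
  obtain ⟨C, hC, hle⟩ := hbound
  refine lt_of_le_of_lt ?_ hC
  have hlim : ∀ ω, Tendsto (fun n => (∑ i ∈ Finset.range n, f i ω) ^ p) atTop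
      (nhds ((∑' n, f n ω) ^ p)) := fun ω =>
    (ENNReal.continuous_rpow_const.tendsto _).comp ENNReal.summable.hasSum.tendsto_sum_nat
  have hmono := lintegral_tendsto_of_tendsto_of_monotone (μ := P)
    (fun n => ((Finset.measurable_fun_sum (Finset.range n) fun i _ => hf i).pow_const
      p).aemeasurable)
    (ae_of_all _ fun ω n n' hn => ENNReal.rpow_le_rpow
      (Finset.sum_le_sum_of_subset (Finset.range_mono hn)) hp.le)
    (ae_of_all _ hlim)
  exact le_of_tendsto' hmono hle

/-! ### Interval returns and independent pairs -/

lemma center_smul_Icc {a e n : ℝ} (ha : 0 ≤ a) (hn : 0 ≤ n) :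
    center (a • Set.Icc (e - n) (e + n)) = a * e := by
  rw [center, Real.sInf_smul_of_nonneg ha, Real.sSup_smul_of_nonneg ha, csInf_Icc (by linarith),
    csSup_Icc (by linarith)]
  simp only [smul_eq_mul]
  ring

lemma radius_smul_Icc {a e n : ℝ} (ha : 0 ≤ a) (hn : 0 ≤ n) :
    radius (a • Set.Icc (e - n) (e + n)) = a * n := by
  rw [radius, Real.sInf_smul_of_nonneg ha, Real.sSup_smul_of_nonneg ha, csInf_Icc (by linarith),
    csSup_Icc (by linarith)]
  simp only [smul_eq_mul]
  ring

lemma ae_nonneg_of_hasLaw_gammaMeasure {Y : Ω → ℝ} {a b : ℝ}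
    (hY : HasLaw Y (gammaMeasure a b) P) : ∀ᵐ ω ∂P, 0 ≤ Y ω := by
  have h0 : gammaMeasure a b (Set.Iio 0) = 0 := by
    rw [gammaMeasure, withDensity_apply _ measurableSet_Iio]
    exact lintegral_gammaPDF_of_nonpos le_rfl
  rw [← hY.map_eq, Measure.map_apply_of_aemeasurable hY.aemeasurable measurableSet_Iio] at h0
  filter_upwards [measure_eq_zero_iff_ae_notMem.1 h0] with ω hω
  simpa using hω

/-- Two independent families of independent random variables form a family of independent pairs. -/
lemma iIndepFun_prodMk {ι : Type*} {X Y : ι → Ω → ℝ} (hX : ∀ i, Measurable (X i))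
    (hY : ∀ i, Measurable (Y i)) (hXi : iIndepFun X P) (hYi : iIndepFun Y P)
    (hXY : IndepFun (fun ω i => X i ω) (fun ω i => Y i ω) P) :
    iIndepFun (fun i ω => (X i ω, Y i ω)) P := by
  -- Measurable rectangles form a generating π-system, so independence need only be checked on them.
  let R : Set (Set (ℝ × ℝ)) :=
    Set.image2 (· ×ˢ ·) {s | MeasurableSet s} {s | MeasurableSet s}
  refine iIndepSets.iIndep (fun i => ((hX i).prodMk (hY i)).comap_le)
    (fun i => Set.preimage (fun ω => (X i ω, Y i ω)) '' R) (fun i => ?_) (fun i => ?_) ?_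
  · exact isPiSystem_prod.comap _
  · rw [← generateFrom_prod, MeasurableSpace.comap_generateFrom]
  · rw [iIndepSets_iff]
    intro s f hf
    have : ∀ i, ∃ A B : Set ℝ, MeasurableSet A ∧ MeasurableSet B ∧
        (i ∈ s → f i = X i ⁻¹' A ∩ Y i ⁻¹' B) := fun i => by
      by_cases hi : i ∈ s
      · obtain ⟨_, ⟨A, hA, B, hB, rfl⟩, h⟩ := hf i hi
        exact ⟨A, B, hA, hB, fun _ => h.symm⟩
      · exact ⟨∅, ∅, .empty, .empty, fun h => absurd h hi⟩
    choose A B hA hB hAB using this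
    have hsplit : ⋂ i ∈ s, f i = (⋂ i ∈ s, X i ⁻¹' A i) ∩ ⋂ i ∈ s, Y i ⁻¹' B i := by
      rw [Set.iInter₂_congr hAB]
      ext ω
      simp [imp_and, forall_and]
    have hbox : P ((⋂ i ∈ s, X i ⁻¹' A i) ∩ ⋂ i ∈ s, Y i ⁻¹' B i) =
        P (⋂ i ∈ s, X i ⁻¹' A i) * P (⋂ i ∈ s, Y i ⁻¹' B i) := by
      have := hXY.measure_inter_preimage_eq_mul ((s : Set ι).pi A) ((s : Set ι).pi B)
        (.pi s.countable_toSet fun i _ => hA i) (.pi s.countable_toSet fun i _ => hB i)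
      have hpi (Z : ι → Ω → ℝ) (D : ι → Set ℝ) :
          (fun ω i => Z i ω) ⁻¹' (s : Set ι).pi D = ⋂ i ∈ s, Z i ⁻¹' D i := by
        ext ω
        simp [Set.mem_pi]
      rwa [hpi, hpi] at this
    rw [hsplit, hbox, hXi.measure_inter_preimage_eq_mul s fun i _ => hA i,
      hYi.measure_inter_preimage_eq_mul s fun i _ => hB i, ← Finset.prod_mul_distrib]
    refine Finset.prod_congr rfl fun i hi => ?_
    rw [hAB i hi]
    exact ((hXY.comp (measurable_pi_apply i)
      (measurable_pi_apply i)).measure_inter_preimage_eq_mul _ _ (hA i) (hB i)).symm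

/-! ### Consequences of the model -/

section Model

variable {k μ α β γ : ℝ} {ε η h : ℤ → Ω → ℝ} {r : ℤ → Ω → Set ℝ}

@[fun_prop]
lemma Model.measurable_coeff (hm : Model P k μ α β γ ε η h r) (t : ℤ) :
    Measurable (coeff α β γ ε η t) := by
  have h1 := hm.measurable_eps (t - 1)
  have h2 := hm.measurable_eta (t - 1)
  unfold coeff
  simp only [← Real.norm_eq_abs]
  fun_prop

lemma Model.iIndepFun_coeff (hm : Model P k μ α β γ ε η h r) :
    iIndepFun (coeff α β γ ε η) P := by
  have h1 := iIndepFun_prodMk hm.measurable_eps hm.measurable_eta hm.indep_eps hm.indep_eta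
    hm.indep_eps_eta
  have h2 : Function.Injective fun t : ℤ => t - 1 := sub_left_injective
  exact (h1.precomp h2).comp (fun _ (z : ℝ × ℝ) => α * |z.1| + β * z.2 + γ) fun _ => by
    simp only [← Real.norm_eq_abs]
    fun_prop

/-- The common law of the random coefficients. -/
noncomputable def coeffLaw (k α β γ : ℝ) : Measure ℝ :=
  ((gaussianReal 0 1).prod (gammaMeasure k 1)).map fun z => α * |z.1| + β * z.2 + γ

lemma Model.map_coeff [IsProbabilityMeasure P] (hm : Model P k μ α β γ ε η h r) (t : ℤ) :
    P.map (coeff α β γ ε η t) = coeffLaw k α β γ := by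
  have h1 : IndepFun (ε (t - 1)) (η (t - 1)) P :=
    hm.indep_eps_eta.comp (measurable_pi_apply (t - 1)) (measurable_pi_apply (t - 1))
  have h2 := h1.map_prod_eq_prod_map_map (hm.measurable_eps _).aemeasurable
    (hm.measurable_eta _).aemeasurable
  rw [(hm.law_eps _).map_eq, (hm.law_eta _).map_eq] at h2
  rw [coeffLaw, ← h2, Measure.map_map]
  · rfl
  · simp only [← Real.norm_eq_abs]
    fun_prop
  · exact (hm.measurable_eps _).prodMk (hm.measurable_eta _)

lemma Model.isProbabilityMeasure_coeffLaw [IsProbabilityMeasure P]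
    (hm : Model P k μ α β γ ε η h r) :
    IsProbabilityMeasure (coeffLaw k α β γ) := by
  rw [← hm.map_coeff 0]
  exact Measure.isProbabilityMeasure_map (hm.measurable_coeff 0).aemeasurable

lemma Model.ae_coeff_nonneg (hm : Model P k μ α β γ ε η h r) (t : ℤ) :
    ∀ᵐ ω ∂P, 0 ≤ coeff α β γ ε η t ω := by
  filter_upwards [ae_nonneg_of_hasLaw_gammaMeasure (hm.law_eta (t - 1))] with ω hω
  have := hm.alpha_pos
  have := hm.beta_pos
  have := hm.gamma_pos
  unfold coeff
  positivity

lemma Model.ae_center_radius (hm : Model P k μ α β γ ε η h r) (t : ℤ) :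
    ∀ᵐ ω ∂P, |center (r t ω)| = h t ω * |ε t ω| ∧ radius (r t ω) = h t ω * η t ω := by
  filter_upwards [ae_nonneg_of_hasLaw_gammaMeasure (hm.law_eta t), hm.h_nonneg t,
    hm.return_eq t] with ω h1 h2 h3
  rw [h3, innovation, center_smul_Icc h2 h1, radius_smul_Icc h2 h1, abs_mul, abs_of_nonneg h2]
  exact ⟨rfl, rfl⟩

lemma Model.ae_recursion (hm : Model P k μ α β γ ε η h r) (t : ℤ) :
    ∀ᵐ ω ∂P, h t ω = μ + coeff α β γ ε η t ω * h (t - 1) ω := by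
  filter_upwards [hm.ae_center_radius (t - 1), hm.scale_eq t] with ω h1 h2
  rw [h2, h1.1, h1.2, coeff]
  ring

/-- The Gaussian has no atom at 0, so `|ε_t|` is rarely small; this lets a bound on `h_t |ε_t|`
control `h_t`. -/
lemma exists_gaussianReal_Ioo_le {δ : ℝ≥0∞} (hδ : 0 < δ) :
    ∃ a : ℝ, 0 < a ∧ gaussianReal 0 1 (Set.Ioo (-a) a) ≤ δ := by
  have := nullSingletonClass_gaussianReal (μ := 0) (v := 1) one_ne_zero
  have h0 : gaussianReal 0 1 {(0 : ℝ)} < δ := by simpa using hδ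
  obtain ⟨U, hU0, hU, hUδ⟩ := Set.exists_isOpen_lt_of_lt _ _ h0
  obtain ⟨a, ha, haU⟩ := Metric.isOpen_iff.1 hU 0 (by simpa using hU0)
  refine ⟨a, ha, (measure_mono ?_).trans hUδ.le⟩
  rwa [Real.ball_eq_Ioo, zero_sub, zero_add] at haU

/-- If `h_t > M`, then either `|ε_t| < a` or `h_t |ε_t| ≥ M a`; Markov's inequality handles the
second event, as `h_t |ε_t|` is at most the norm of the return. -/
lemma Model.measure_abs_gt_le (hm : Model P k μ α β γ ε η h r) {a : ℝ} (ha : 0 < a) {M : ℕ}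
    (hM : 0 < M) (t : ℤ) :
    P {ω | (M : ℝ) < |h t ω|} ≤ gaussianReal 0 1 (Set.Ioo (-a) a) +
      (∫⁻ ω, ENNReal.ofReal (|center (r t ω)| + radius (r t ω)) ∂P) /
        ENNReal.ofReal (M * a) := by
  have hmeas : Measurable fun ω => ENNReal.ofReal (h t ω * |ε t ω|) := by
    have h1 := hm.measurable_eps t
    have h2 := hm.measurable_h t
    simp only [← Real.norm_eq_abs]
    fun_prop
  have hpos : 0 < (M : ℝ) * a := by positivity
  have hmono : P {ω | (M : ℝ) < |h t ω|} ≤ P ((ε t ⁻¹' Set.Ioo (-a) a) ∪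
      {ω | ENNReal.ofReal (M * a) ≤ ENNReal.ofReal (h t ω * |ε t ω|)}) := by
    refine measure_mono_ae ?_
    filter_upwards [hm.h_nonneg t] with ω h1 (h2 : (M : ℝ) < |h t ω|)
    rw [abs_of_nonneg h1] at h2
    by_cases h3 : |ε t ω| < a
    · exact Or.inl (abs_lt.1 h3)
    · exact Or.inr (ENNReal.ofReal_le_ofReal
        (mul_le_mul h2.le (not_lt.1 h3) ha.le h1))
  refine hmono.trans ((measure_union_le _ _).trans (add_le_add (le_of_eq ?_) ?_))
  · rw [← (hm.law_eps t).map_eq, Measure.map_apply (hm.measurable_eps t) measurableSet_Ioo]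
  · refine (meas_ge_le_lintegral_div hmeas.aemeasurable (ENNReal.ofReal_pos.2 hpos).ne'
      ENNReal.ofReal_ne_top).trans ?_
    gcongr ?_ / _
    refine lintegral_mono_ae ?_
    filter_upwards [hm.ae_center_radius t, hm.h_nonneg t,
      ae_nonneg_of_hasLaw_gammaMeasure (hm.law_eta t)] with ω h1 h2 h3
    rw [h1.1, h1.2]
    exact ENNReal.ofReal_le_ofReal (le_add_of_nonneg_right (mul_nonneg h2 h3))

/-- Started from the infinite past with a finite mean, the scale process is tight along a sequence
of times tending to `-∞`. -/
lemma Model.tight_past (hm : Model P k μ α β γ ε η h r) (hpast : FiniteMeanPast P r) (t : ℤ)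
    {δ : ℝ≥0∞} (hδ : 0 < δ) :
    ∃ M : ℕ, ∃ᶠ n : ℕ in atTop, P {ω | (M : ℝ) < |h (t - n) ω|} ≤ δ := by
  -- `δ` may be `∞`; a finite `δ'` is needed to divide by `δ' / 2`.
  obtain ⟨δ', hδ', hδδ⟩ := exists_between (lt_min hδ (ENNReal.one_lt_top.trans' one_pos))
  have hδ1 : δ' ≠ ∞ := (hδδ.trans_le (min_le_right _ _)).ne
  have hδ2 : δ' ≤ δ := (hδδ.trans_le (min_le_left _ _)).le
  obtain ⟨a, ha, haδ⟩ := exists_gaussianReal_Ioo_le (ENNReal.half_pos hδ'.ne')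
  obtain ⟨C, hC1, hC2⟩ := exists_between hpast
  have hfreq := frequently_lt_of_liminf_lt (by isBoundedDefault) hC1
  have ha' : ENNReal.ofReal a ≠ 0 := by simpa using ha
  have hhalf : δ' / 2 ≠ 0 := (ENNReal.half_pos hδ'.ne').ne'
  have hhalf' : δ' / 2 ≠ ∞ := (ENNReal.half_lt_self hδ'.ne' hδ1).ne_top
  -- Chosen so that the Markov term `C / (M a)` is at most `δ' / 2`.
  obtain ⟨M, hM⟩ := ENNReal.exists_nat_gt
    (ENNReal.div_ne_top (ENNReal.div_ne_top hC2.ne ha') hhalf)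
  have hM0 : 0 < M := by
    rcases Nat.eq_zero_or_pos M with rfl | h0
    · simp at hM
    · exact h0
  refine ⟨M, frequently_atTop.2 fun N => ?_⟩
  obtain ⟨s, hs, hsC⟩ := frequently_atBot.1 hfreq (t - N)
  refine ⟨(t - s).toNat, by lia, ?_⟩
  have hts : t - ((t - s).toNat : ℤ) = s := by lia
  rw [hts]
  refine ((hm.measure_abs_gt_le ha hM0 s).trans (add_le_add haδ ?_)).trans
    ((ENNReal.add_halves δ').le.trans hδ2)
  refine ENNReal.div_le_of_le_mul (hsC.le.trans ?_)
  rw [ENNReal.ofReal_mul (Nat.cast_nonneg M), ENNReal.ofReal_natCast]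
  have h1 := (ENNReal.div_le_iff hhalf hhalf').1 hM.le
  have h2 := (ENNReal.div_le_iff ha' ENNReal.ofReal_ne_top).1 h1
  calc C ≤ _ := h2
    _ = _ := by ring

lemma Model.lintegral_ofReal_coeff_rpow [IsProbabilityMeasure P]
    (hm : Model P k μ α β γ ε η h r) (p : ℝ) (t : ℤ) :
    ∫⁻ ω, ENNReal.ofReal (coeff α β γ ε η t ω) ^ p ∂P =
      ∫⁻ x, ENNReal.ofReal x ^ p ∂coeffLaw k α β γ := by
  rw [← hm.map_coeff t, lintegral_map (by fun_prop) (hm.measurable_coeff t)]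

/-- The scale process is almost surely the perpetuity driven by the random coefficients. -/
lemma Model.ae_eq_perpetuity [IsProbabilityMeasure P] (hm : Model P k μ α β γ ε η h r)
    (hpast : FiniteMeanPast P r)
    (hmean : ∀ t, ∫⁻ ω, ENNReal.ofReal (coeff α β γ ε η t ω) ∂P < 1) :
    ∀ᵐ ω ∂P, ∀ t, h t ω =
      μ * (perpetuity (fun s => coeff α β γ ε η s ω) t).toReal := by
  have hconst (t : ℤ) : ∫⁻ ω, ENNReal.ofReal (coeff α β γ ε η t ω) ∂P =
      ∫⁻ x, ENNReal.ofReal x ∂coeffLaw k α β γ := by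
    simpa using hm.lintegral_ofReal_coeff_rpow 1 t
  have hlt : ∫⁻ x, ENNReal.ofReal x ∂coeffLaw k α β γ < 1 := hconst 0 ▸ hmean 0
  filter_upwards [ae_all_iff.2 hm.ae_coeff_nonneg, ae_all_iff.2 hm.ae_recursion,
    ae_all_iff.2 fun t => ae_perpetuity_ne_top hm.measurable_coeff hm.iIndepFun_coeff hlt hconst t,
    ae_all_iff.2 fun t : ℤ => ae_frequently_abs_le_of_tight (Z := fun n : ℕ => h (t - n))
      fun δ hδ => hm.tight_past hpast t hδ] with ω h1 h2 h3 h4 t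
  obtain ⟨M, hM⟩ := h4 t
  exact eq_perpetuity_of_recursion h1 h2 (h3 t) hM

end Model

/-! ### Stationarity and ergodicity as a factor of the Bernoulli shift -/

/-- The path of a perpetuity with constant forcing `μ`, as a function of the coefficients. -/
noncomputable def perpetuityPath (μ : ℝ) (y : ℤ → ℝ) : ℤ → ℝ :=
  fun t => μ * (perpetuity y t).toReal

@[fun_prop]
lemma measurable_perpetuityPath (μ : ℝ) : Measurable (perpetuityPath μ) := by
  unfold perpetuityPath
  fun_prop

lemma perpetuityPath_translate (μ : ℝ) (y : ℤ → ℝ) (s : ℤ) :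
    perpetuityPath μ (fun u => y (u + s)) = fun t => perpetuityPath μ y (t + s) := by
  funext t
  simp only [perpetuityPath, perpetuity_translate]

lemma strictlyStationary_of_ae_eq_perpetuityPath {ρ : Measure ℝ} [IsProbabilityMeasure ρ] {μ : ℝ}
    {X h : ℤ → Ω → ℝ} (hX : Measurable fun ω t => X t ω)
    (hlaw : P.map (fun ω t => X t ω) = Measure.infinitePi fun _ : ℤ => ρ)
    (hh : ∀ᵐ ω ∂P, ∀ t, h t ω = perpetuityPath μ (fun s => X s ω) t) :
    StrictlyStationary P h := by
  intro n t s
  let G : (ℤ → ℝ) → (Fin n → ℝ) := fun y i => perpetuityPath μ y (t i)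
  have hG : Measurable G :=
    measurable_pi_iff.2 fun i => (measurable_pi_apply _).comp (measurable_perpetuityPath μ)
  have hmp := measurePreserving_shift_infinitePi ρ s
  have h1 : P.map (fun ω i => h (t i) ω) = (Measure.infinitePi fun _ : ℤ => ρ).map G := by
    rw [← hlaw, Measure.map_map hG hX]
    refine Measure.map_congr ?_
    filter_upwards [hh] with ω hω
    funext i
    exact hω _
  have h2 : P.map (fun ω i => h (t i + s) ω) =
      (Measure.infinitePi fun _ : ℤ => ρ).map (G ∘ fun y u => y (u + s)) := by
    rw [← hlaw, Measure.map_map (hG.comp hmp.measurable) hX]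
    refine Measure.map_congr ?_
    filter_upwards [hh] with ω hω
    funext i
    exact (hω _).trans (congrFun (perpetuityPath_translate μ _ s) _).symm
  rw [h1, h2, ← Measure.map_map hG hmp.measurable, hmp.map_eq]

lemma ergodicProcess_of_ae_eq_perpetuityPath {ρ : Measure ℝ} [IsProbabilityMeasure ρ] {μ : ℝ}
    {X h : ℤ → Ω → ℝ} (hX : Measurable fun ω t => X t ω)
    (hlaw : P.map (fun ω t => X t ω) = Measure.infinitePi fun _ : ℤ => ρ)
    (hh : ∀ᵐ ω ∂P, ∀ t, h t ω = perpetuityPath μ (fun s => X s ω) t) :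
    ErgodicProcess P h := by
  have h1 : P.map (fun ω t => h t ω) =
      (Measure.infinitePi fun _ : ℤ => ρ).map (perpetuityPath μ) := by
    rw [← hlaw, Measure.map_map (measurable_perpetuityPath μ) hX]
    refine Measure.map_congr ?_
    filter_upwards [hh] with ω hω
    funext t
    exact hω t
  have hshift : Measurable shift := (measurePreserving_shift_infinitePi ρ 1).measurable
  rw [ErgodicProcess, h1]
  exact MeasurePreserving.ergodic_of_ergodic_semiconj
    ((measurable_perpetuityPath μ).measurePreserving _) (ergodic_shift_infinitePi ρ) hshift
    fun y => perpetuityPath_translate μ y 1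

end IntGARCH

theorem mainTheorem9 {Ω : Type*} [MeasurableSpace Ω] (P : Measure Ω) [IsProbabilityMeasure P]
    (k μ α β γ : ℝ) (ε η h : ℤ → Ω → ℝ) (r : ℤ → Ω → Set ℝ)
    (hmodel : IntGARCH.Model P k μ α β γ ε η h r)
    (hpast : IntGARCH.FiniteMeanPast P r)
    (hmean : ∀ t, ∫⁻ ω, ENNReal.ofReal (IntGARCH.coeff α β γ ε η t ω) ∂P < 1) :
    IntGARCH.StrictlyStationary P h ∧ IntGARCH.ErgodicProcess P h ∧
      ∀ p : ℝ, 0 < p →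
        (∀ t, ∫⁻ ω, ENNReal.ofReal (IntGARCH.coeff α β γ ε η t ω ^ p) ∂P < 1) →
        ∀ t, ∫⁻ ω, ENNReal.ofReal (h t ω ^ p) ∂P < ∞ := by
  have := hmodel.isProbabilityMeasure_coeffLaw
  have hX : Measurable fun ω t => IntGARCH.coeff α β γ ε η t ω :=
    measurable_pi_iff.2 hmodel.measurable_coeff
  have hlaw : P.map (fun ω t => IntGARCH.coeff α β γ ε η t ω) =
      Measure.infinitePi fun _ : ℤ => IntGARCH.coeffLaw k α β γ := by
    rw [hmodel.iIndepFun_coeff.map_fun_eq_infinitePi_map hmodel.measurable_coeff]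
    simp only [hmodel.map_coeff]
  have hh := hmodel.ae_eq_perpetuity hpast hmean
  refine ⟨IntGARCH.strictlyStationary_of_ae_eq_perpetuityPath hX hlaw hh,
    IntGARCH.ergodicProcess_of_ae_eq_perpetuityPath hX hlaw hh, fun p hp hmom t => ?_⟩
  have hq : ∫⁻ x, ENNReal.ofReal x ^ p ∂IntGARCH.coeffLaw k α β γ < 1 := by
    rw [← hmodel.lintegral_ofReal_coeff_rpow p 0]
    refine lt_of_eq_of_lt (lintegral_congr_ae ?_) (hmom 0)
    -- Truncating at 0 and taking real powers commute only for a nonnegative base.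
    filter_upwards [hmodel.ae_coeff_nonneg 0] with ω hω
    exact ENNReal.ofReal_rpow_of_nonneg hω hp.le
  have hG : ∫⁻ ω, IntGARCH.perpetuity (fun s => IntGARCH.coeff α β γ ε η s ω) t ^ p ∂P < ∞ :=
    IntGARCH.lintegral_tsum_rpow_lt_top
      (fun n => (IntGARCH.measurable_backwardProd t n).comp hX) hp hq
      (IntGARCH.lintegral_backwardProd_rpow hmodel.measurable_coeff hmodel.iIndepFun_coeff hp.le
        (hmodel.lintegral_ofReal_coeff_rpow p) t)
  calc ∫⁻ ω, ENNReal.ofReal (h t ω ^ p) ∂P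
      ≤ ∫⁻ ω, ENNReal.ofReal |μ| ^ p *
          IntGARCH.perpetuity (fun s => IntGARCH.coeff α β γ ε η s ω) t ^ p ∂P := by
        refine lintegral_mono_ae ?_
        filter_upwards [hh, hmodel.h_nonneg t] with ω h1 h2
        rw [← ENNReal.ofReal_rpow_of_nonneg h2 hp.le, ← ENNReal.mul_rpow_of_nonneg _ _ hp.le]
        refine ENNReal.rpow_le_rpow ?_ hp.le
        -- The sign of `μ` is unknown, so the bound goes through `|h t ω|`.
        rw [← abs_of_nonneg h2, h1 t, abs_mul, ENNReal.ofReal_mul (abs_nonneg μ),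
          abs_of_nonneg ENNReal.toReal_nonneg]
        gcongr
        exact ENNReal.ofReal_toReal_le
    _ = ENNReal.ofReal |μ| ^ p * ∫⁻ ω,
          IntGARCH.perpetuity (fun s => IntGARCH.coeff α β γ ε η s ω) t ^ p ∂P :=
        lintegral_const_mul' _ _ (ENNReal.rpow_ne_top_of_nonneg hp.le ENNReal.ofReal_ne_top)
    _ < ∞ := ENNReal.mul_lt_top
        (ENNReal.rpow_lt_top_of_nonneg hp.le ENNReal.ofReal_ne_top) hG
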